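/- A \emph{robot} is a nonempty, bounded, convex set $\mathbb{S}\subset\mathbb{R}^2$ with $-\mathbb S=\mathbb S$; $\mathbb Z[P]=P+\mathbb Z$ is its placement at $P$. The \emph{reach} of a set $S\subset\mathbb R^2$ is $r_S(\theta)=\sup\{x\cos\theta+y\sin\theta:(x,y)\in S\}$. For robots $\mathbb A,\mathbb B$ and positions $A,B\in\mathbb{R}^2$, the \emph{separation} of $\mathbb A[A]$ from $\mathbb B[B]$ in direction $\theta$ is $r_{\mathbb A[A]}(\theta)-r_{\mathbb B[B]}(\theta)-2r_{\mathbb A}(\theta)$. The configuration $(\mathbb A[A],\mathbb B[B])$ is \emph{viable} if its separation is nonnegative in some direction (this always holds if $\mathbb A[A]\cap\mathbb B[B]=\emptyset$, and for open robots it is equivalent to it), and an \emph{orientation} of it is any direction $\theta$ that maximizes the separation. A \emph{motion} from $Z_0$ to $Z_1$ is a continuous rectifiable curve $\xi:[0,1]\to\mathbb R^2$ with $\xi(0)=Z_0$, $\xi(1)=Z_1$, and $\ell(\xi)$ is its arc length. A \emph{co-motion} from $(\mathbb A[A_0],\mathbb B[B_0])$ to $(\mathbb A[A_1],\mathbb B[B_1])$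 is a pair $m=(\xi_{\mathbb A},\xi_{\mathbb B})$ of motions from $A_0$ to $A_1$ and from $B_0$ to $B_1$; its length is $\ell(m)=\ell(\xi_{\mathbb A})+\ell(\xi_{\mathbb B})$, and it is \emph{collision-free} if $(\mathbb A[\xi_{\mathbb A}(t)],\mathbb B[\xi_{\mathbb B}(t)])$ is viable for all $t\in[0,1]$. Let $\theta_0$ and $\theta_1$ be orientations of the initial and of the goal configuration, represented by real numbers with $\theta_0\le\theta_1\le\theta_0+2\pi$, and let $[\theta_0,\theta_1]\subseteq S^1=\mathbb R/2\pi\mathbb Z$ be the arc of directions from $\theta_0$ counter-clockwise to $\theta_1$. The co-motion $m$ is \emph{net counter-clockwise} (with respect to $\theta_0,\theta_1$) if every direction in $[\theta_0,\theta_1]$ is an orientation of $(\mathbb A[\xi_{\mathbb A}(t)],\mathbb B[\xi_{\mathbb B}(t)])$ for some $t\in[0,1]$. \textbf{Lemma.} Let $m$ be any collision-free net counter-clockwise co-motion from $(\mathbb A[A_0],\mathbb B[B_0])$ to $(\mathbb A[A_1],\mathbb B[B_1])$. Then $$\ell(m)\ \ge\ \int_{S^1} h(\theta)\,d\theta-|\overline{A_0A_1}|-|\overline{B_0B_1}|,$$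 where $\overline{A_0A_1}$ and $\overline{B_0B_1}$ denote the closed segments, $$h(\theta)=\begin{cases}\max\bigl(r_{\overline{A_0A_1}}(\theta)+r_{\overline{B_0B_1}}(\pi+\theta),\ r_{\mathbb A+\mathbb B}(\theta)\bigr)&\text{if }\theta\in[\theta_0,\theta_1],\\ r_{\overline{A_0A_1}}(\theta)+r_{\overline{B_0B_1}}(\pi+\theta)&\text{if }\theta\notin[\theta_0,\theta_1],\end{cases}$$ and $\mathbb A+\mathbb B$ is the Minkowski sum. -/

import Mathlib

open Real Set MeasureTheory
open scoped Pointwise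

/-- The Euclidean plane. -/
abbrev Plane : Type := EuclideanSpace ℝ (Fin 2)

/-- The functional `x cos θ + y sin θ` on the plane. -/
noncomputable def dirCoord (θ : ℝ) (p : Plane) : ℝ := p 0 * cos θ + p 1 * sin θ

/-- The reach (support function) of a set of points in direction `θ`. -/
noncomputable def reach (S : Set Plane) (θ : ℝ) : ℝ := sSup (dirCoord θ '' S)

/-- A robot in standard placement: a convex, centrally-symmetric region of the plane. It is not
assumed to be open or closed, and it may be degenerate (a segment or a point). -/
structure IsRobot (S : Set Plane) : Prop where
  nonempty : S.Nonempty
  bounded : Bornology.IsBounded S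
  convex : Convex ℝ S
  symmetric : ∀ p ∈ S, -p ∈ S

/-- The placement of the robot `Z` at the position `P`. -/
def place (Z : Set Plane) (P : Plane) : Set Plane := (fun p => P + p) '' Z

/-- The separation, in direction `θ`, of the robot `A` placed at `P` from the robot `B`
placed at `Q`. -/
noncomputable def separation (A B : Set Plane) (P Q : Plane) (θ : ℝ) : ℝ :=
  reach (place A P) θ - reach (place B Q) θ - 2 * reach A θ

/-- The configuration with `A` at `P` and `B` at `Q` is viable: the separation is nonnegative in
some direction. Disjoint placements are always viable (`viable_of_disjoint`), and the two notions
agree for open robots (`viable_iff_disjoint`). For robots which contain boundary points, placements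
that merely touch are viable as well. -/
def Viable (A B : Set Plane) (P Q : Plane) : Prop := ∃ θ : ℝ, 0 ≤ separation A B P Q θ

/-- `θ` is an orientation of the configuration with `A` at `P` and `B` at `Q`: a direction that
maximizes the separation. Such a direction need not be unique for configurations in contact, where
all the maximizing directions count. -/
def IsOrientation (A B : Set Plane) (P Q : Plane) (θ : ℝ) : Prop :=
  ∀ φ : ℝ, separation A B P Q φ ≤ separation A B P Q θ

/-- A motion from position `Z₀` to position `Z₁`: a continuous rectifiable curve on `[0,1]`
(the values of `path` outside `[0,1]` play no role). -/
structure Motion (Z₀ Z₁ : Plane) where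
  path : ℝ → Plane
  continuousOn : ContinuousOn path (Icc 0 1)
  rectifiable : eVariationOn path (Icc 0 1) ≠ ⊤
  source : path 0 = Z₀
  target : path 1 = Z₁

/-- The arc length of a motion, the supremum over all subdivisions of `[0,1]`. -/
noncomputable def Motion.length {Z₀ Z₁ : Plane} (ξ : Motion Z₀ Z₁) : ℝ :=
  (eVariationOn ξ.path (Icc 0 1)).toReal

/-- A co-motion of a robot pair, from positions `A₀, B₀` to positions `A₁, B₁`. -/
structure CoMotion (A₀ B₀ A₁ B₁ : Plane) where
  motionA : Motion A₀ A₁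
  motionB : Motion B₀ B₁

namespace CoMotion

variable {A₀ B₀ A₁ B₁ : Plane}

noncomputable def length (m : CoMotion A₀ B₀ A₁ B₁) : ℝ := m.motionA.length + m.motionB.length

def CollisionFree (A B : Set Plane) (m : CoMotion A₀ B₀ A₁ B₁) : Prop :=
  ∀ t ∈ Icc (0 : ℝ) 1, Viable A B (m.motionA.path t) (m.motionB.path t)

/-- The range of orientations realized by the configurations of a co-motion. -/
def orientations (A B : Set Plane) (m : CoMotion A₀ B₀ A₁ B₁) : Set ℝ :=
  {θ | ∃ t ∈ Icc (0 : ℝ) 1, IsOrientation A B (m.motionA.path t) (m.motionB.path t) θ}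

end CoMotion

/-- The directions which lie counter-clockwise between `θ₀` and `θ₁`, as a `2π`-periodic set of
real numbers. It is used for `θ₀ ≤ θ₁ ≤ θ₀ + 2π`. -/
def ccwArc (θ₀ θ₁ : ℝ) : Set ℝ := {θ | ∃ k : ℤ, θ + k * (2 * π) ∈ Icc θ₀ θ₁}

/-- `m` is net counter-clockwise with respect to the orientations `θ₀` (of its initial
configuration) and `θ₁` (of its goal configuration). -/
def CoMotion.NetCCW {A₀ B₀ A₁ B₁ : Plane} (A B : Set Plane) (m : CoMotion A₀ B₀ A₁ B₁)
    (θ₀ θ₁ : ℝ) : Prop :=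
  ccwArc θ₀ θ₁ ⊆ m.orientations A B

/-- `r_{A₀A₁}(θ) + r_{B₀B₁}(π + θ)` -/
noncomputable def segmentReach (A₀ B₀ A₁ B₁ : Plane) (θ : ℝ) : ℝ :=
  reach (segment ℝ A₀ A₁) θ + reach (segment ℝ B₀ B₁) (π + θ)

open Classical in
/-- The function under the integral: the larger of `r_{A₀A₁}(θ) + r_{B₀B₁}(π + θ)` and
`r_{A+B}(θ)` for `θ` in the arc, and `r_{A₀A₁}(θ) + r_{B₀B₁}(π + θ)` off the arc. -/
noncomputable def ccwReach (A B : Set Plane) (A₀ B₀ A₁ B₁ : Plane) (θ₀ θ₁ θ : ℝ) : ℝ :=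
  if θ ∈ ccwArc θ₀ θ₁ then max (segmentReach A₀ B₀ A₁ B₁ θ) (reach (A + B) θ)
  else segmentReach A₀ B₀ A₁ B₁ θ

/-! Disjointness and viability. -/

theorem dirCoord_add (θ : ℝ) (p q : Plane) : dirCoord θ (p + q) = dirCoord θ p + dirCoord θ q := by
  simp only [dirCoord, PiLp.add_apply]; ring

theorem dirCoord_neg (θ : ℝ) (p : Plane) : dirCoord θ (-p) = -dirCoord θ p := by
  simp only [dirCoord, PiLp.neg_apply]; ring

theorem abs_dirCoord_le (θ : ℝ) (p : Plane) : |dirCoord θ p| ≤ 2 * ‖p‖ := by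
  have h0 : |p 0| ≤ ‖p‖ := PiLp.norm_apply_le p 0
  have h1 : |p 1| ≤ ‖p‖ := PiLp.norm_apply_le p 1
  calc |dirCoord θ p| ≤ |p 0 * cos θ| + |p 1 * sin θ| := abs_add_le _ _
    _ = |p 0| * |cos θ| + |p 1| * |sin θ| := by rw [abs_mul, abs_mul]
    _ ≤ |p 0| * 1 + |p 1| * 1 := by
        gcongr
        · exact abs_cos_le_one θ
        · exact abs_sin_le_one θ
    _ ≤ 2 * ‖p‖ := by linarith

theorem bddAbove_dirCoord {S : Set Plane} (hS : Bornology.IsBounded S) (θ : ℝ) :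
    BddAbove (dirCoord θ '' S) := by
  obtain ⟨C, hC⟩ := hS.exists_norm_le
  refine ⟨2 * C, ?_⟩
  rintro _ ⟨p, hp, rfl⟩
  have := hC p hp
  linarith [le_abs_self (dirCoord θ p), abs_dirCoord_le θ p]

theorem dirCoord_le_reach {S : Set Plane} (hS : Bornology.IsBounded S) (θ : ℝ) {p : Plane}
    (hp : p ∈ S) : dirCoord θ p ≤ reach S θ :=
  le_csSup (bddAbove_dirCoord hS θ) ⟨p, hp, rfl⟩

theorem reach_le {S : Set Plane} (hS : S.Nonempty) {θ c : ℝ} (h : ∀ p ∈ S, dirCoord θ p ≤ c) :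
    reach S θ ≤ c :=
  csSup_le (hS.image _) (by rintro _ ⟨p, hp, rfl⟩; exact h p hp)

theorem reach_place {Z : Set Plane} (hZ : IsRobot Z) (P : Plane) (θ : ℝ) :
    reach (place Z P) θ = dirCoord θ P + reach Z θ := by
  have hb : BddAbove (dirCoord θ '' place Z P) := by
    refine ⟨dirCoord θ P + reach Z θ, ?_⟩
    rintro _ ⟨_, ⟨z, hz, rfl⟩, rfl⟩
    rw [dirCoord_add]
    linarith [dirCoord_le_reach hZ.bounded θ hz]
  apply le_antisymm
  · refine reach_le (hZ.nonempty.image _) ?_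
    rintro _ ⟨z, hz, rfl⟩
    rw [dirCoord_add]
    linarith [dirCoord_le_reach hZ.bounded θ hz]
  · have : reach Z θ ≤ reach (place Z P) θ - dirCoord θ P := by
      refine reach_le hZ.nonempty fun z hz => ?_
      have := le_csSup hb ⟨P + z, ⟨z, hz, rfl⟩, rfl⟩
      rw [dirCoord_add] at this
      simp only [reach]; linarith
    linarith

theorem separation_eq {A B : Set Plane} (hA : IsRobot A) (hB : IsRobot B) (P Q : Plane) (θ : ℝ) :
    separation A B P Q θ = dirCoord θ (P - Q) - (reach A θ + reach B θ) := by
  rw [separation, reach_place hA, reach_place hB, sub_eq_add_neg P Q, dirCoord_add, dirCoord_neg]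
  ring

/-- A nonzero linear functional is a positive multiple of some `dirCoord θ`. -/
theorem exists_dirCoord (f : Plane →ₗ[ℝ] ℝ) (hf : f ≠ 0) :
    ∃ θ c : ℝ, 0 < c ∧ ∀ p, f p = c * dirCoord θ p := by
  have hp : ∀ p : Plane, f p = p 0 * f (EuclideanSpace.single 0 1)
      + p 1 * f (EuclideanSpace.single 1 1) := by
    intro p
    have : p = p 0 • EuclideanSpace.single 0 (1 : ℝ) + p 1 • EuclideanSpace.single 1 (1 : ℝ) := by
      ext i; fin_cases i <;> simp
    conv_lhs => rw [this]
    simp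
  set a := f (EuclideanSpace.single 0 1)
  set b := f (EuclideanSpace.single 1 1)
  set z : ℂ := ⟨a, b⟩ with hz
  refine ⟨z.arg, ‖z‖, ?_, fun p => ?_⟩
  · rw [norm_pos_iff]
    intro h
    apply hf
    ext p
    have ha : a = 0 := by simpa [hz] using congrArg Complex.re h
    have hb : b = 0 := by simpa [hz] using congrArg Complex.im h
    rw [hp, ha, hb]; simp
  · have h1 : ‖z‖ * cos z.arg = a := Complex.norm_mul_cos_arg z
    have h2 : ‖z‖ * sin z.arg = b := Complex.norm_mul_sin_arg z
    rw [hp, ← h1, ← h2, dirCoord]; ring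

theorem exists_support {K : Set Plane} (hK : Convex ℝ K) (h0 : (0 : Plane) ∈ K) {v : Plane}
    (hv : v ∉ K) : ∃ f : Plane →ₗ[ℝ] ℝ, f ≠ 0 ∧ ∀ x ∈ K, f x ≤ f v := by
  rcases (interior K).eq_empty_or_nonempty with he | hne
  · have hspan : Submodule.span ℝ K ≠ ⊤ := by
      intro h
      have : affineSpan ℝ K = ⊤ := by
        rw [AffineSubspace.affineSpan_eq_top_iff_vectorSpan_eq_top_of_nonempty ℝ Plane Plane ⟨0, h0⟩,
          eq_top_iff, ← h]
        refine Submodule.span_le.2 fun x hx => ?_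
        simpa using vsub_mem_vectorSpan ℝ hx h0
      exact (hK.interior_nonempty_iff_affineSpan_eq_top.2 this).ne_empty he
    obtain ⟨f, hf, hle⟩ := Submodule.exists_le_ker_of_lt_top _ (lt_top_iff_ne_top.2 hspan)
    have hz : ∀ x ∈ K, f x = 0 := fun x hx => hle (Submodule.subset_span hx)
    rcases le_total 0 (f v) with h | h
    · exact ⟨f, hf, fun x hx => by rw [hz x hx]; exact h⟩
    · exact ⟨-f, neg_ne_zero.2 hf, fun x hx => by simp [hz x hx, h]⟩
  · obtain ⟨f, hf⟩ := geometric_hahn_banach_open_point hK.interior isOpen_interior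
      (fun h => hv (interior_subset h))
    refine ⟨f.toLinearMap, ?_, fun x hx => ?_⟩
    · rintro h
      obtain ⟨y, hy⟩ := hne
      have := hf y hy
      have e : ∀ x, f x = 0 := fun x => by simpa using LinearMap.congr_fun h x
      simp [e] at this
    · have hx' : x ∈ closure (interior K) := by
        rw [hK.closure_interior_eq_closure_of_nonempty_interior hne]
        exact subset_closure hx
      exact closure_minimal (t := {y | f y ≤ f v}) (fun y hy => (hf y hy).le)
        (isClosed_le f.continuous continuous_const) hx'

theorem IsRobot.zero_mem {S : Set Plane} (hS : IsRobot S) : (0 : Plane) ∈ S := by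
  obtain ⟨p, hp⟩ := hS.nonempty
  have := hS.convex hp (hS.symmetric p hp) (by norm_num : (0 : ℝ) ≤ 1 / 2)
    (by norm_num : (0 : ℝ) ≤ 1 / 2) (by norm_num)
  simpa using this

theorem viable_of_disjoint {A B : Set Plane} (hA : IsRobot A) (hB : IsRobot B) {P Q : Plane}
    (h : Disjoint (place A P) (place B Q)) : Viable A B P Q := by
  have hv : P - Q ∉ A + B := by
    rintro ⟨a, ha, b, hb, hab⟩
    refine Set.disjoint_left.1 h ⟨-a, hA.symmetric a ha, rfl⟩ ⟨b, hb, ?_⟩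
    simp only at hab ⊢
    rw [add_comm Q b, ← sub_eq_add_neg, eq_sub_iff_add_eq, add_right_comm, add_comm b a, hab,
      sub_add_cancel]
  have h0 : (0 : Plane) ∈ A + B := ⟨0, hA.zero_mem, 0, hB.zero_mem, by simp⟩
  obtain ⟨f, hf, hle⟩ := exists_support (hA.convex.add hB.convex) h0 hv
  obtain ⟨θ, c, hc, hθ⟩ := exists_dirCoord f hf
  refine ⟨θ, ?_⟩
  rw [separation_eq hA hB, sub_nonneg]
  have key : ∀ a ∈ A, ∀ b ∈ B, dirCoord θ a + dirCoord θ b ≤ dirCoord θ (P - Q) := by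
    intro a ha b hb
    have := hle (a + b) ⟨a, ha, b, hb, rfl⟩
    rw [hθ, hθ, dirCoord_add] at this
    exact le_of_mul_le_mul_left this hc
  have h1 : reach A θ ≤ dirCoord θ (P - Q) - reach B θ := by
    refine reach_le hA.nonempty fun a ha => ?_
    have : reach B θ ≤ dirCoord θ (P - Q) - dirCoord θ a :=
      reach_le hB.nonempty fun b hb => by linarith [key a ha b hb]
    linarith
  linarith

/-- In an open set the reach is not attained. -/
theorem dirCoord_lt_reach {S : Set Plane} (hS : IsRobot S) (ho : IsOpen S) (θ : ℝ) {p : Plane}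
    (hp : p ∈ S) : dirCoord θ p < reach S θ := by
  set u : Plane := !₂[cos θ, sin θ] with hu
  have hc : Continuous fun s : ℝ => p + s • u := by fun_prop
  have hn : {s : ℝ | p + s • u ∈ S} ∈ nhds (0 : ℝ) :=
    (ho.preimage hc).mem_nhds (by simpa using hp)
  obtain ⟨ε, hε, hb⟩ := Metric.mem_nhds_iff.1 hn
  have hm : p + (ε / 2) • u ∈ S := hb (by
    rw [Metric.mem_ball, dist_zero_right, norm_eq_abs, abs_of_pos (by positivity)]; linarith)
  have := dirCoord_le_reach hS.bounded θ hm
  have e : dirCoord θ (p + (ε / 2) • u) = dirCoord θ p + ε / 2 := by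
    rw [dirCoord_add]
    simp only [dirCoord, hu, PiLp.smul_apply, smul_eq_mul]
    simp only [Matrix.cons_val_zero, Matrix.cons_val_one]
    linear_combination (ε / 2) * cos_sq_add_sin_sq θ
  linarith

theorem viable_iff_disjoint {A B : Set Plane} (hA : IsRobot A) (hB : IsRobot B) (hoA : IsOpen A)
    (hoB : IsOpen B) (P Q : Plane) : Viable A B P Q ↔ Disjoint (place A P) (place B Q) := by
  refine ⟨?_, viable_of_disjoint hA hB⟩
  rintro ⟨θ, hθ⟩
  rw [separation_eq hA hB, sub_eq_add_neg P, dirCoord_add, dirCoord_neg] at hθ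
  rw [Set.disjoint_left]
  rintro _ ⟨a, ha, rfl⟩ ⟨b, hb, hab⟩
  have h1 := dirCoord_lt_reach hA hoA θ (hA.symmetric a ha)
  have h2 := dirCoord_lt_reach hB hoB θ hb
  have h3 := congrArg (dirCoord θ) hab
  simp only [dirCoord_add] at h3
  rw [dirCoord_neg] at h1
  linarith

/-! The integral is a genuine one. -/

theorem abs_dirCoord_sub_le (θ φ : ℝ) (p : Plane) :
    |dirCoord θ p - dirCoord φ p| ≤ 2 * ‖p‖ * |θ - φ| := by
  have h0 : |p 0| ≤ ‖p‖ := PiLp.norm_apply_le p 0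
  have h1 : |p 1| ≤ ‖p‖ := PiLp.norm_apply_le p 1
  have e : dirCoord θ p - dirCoord φ p = p 0 * (cos θ - cos φ) + p 1 * (sin θ - sin φ) := by
    simp only [dirCoord]; ring
  have hc : |cos θ - cos φ| ≤ |θ - φ| := abs_cos_sub_cos_le θ φ
  have hs : |sin θ - sin φ| ≤ |θ - φ| := abs_sin_sub_sin_le θ φ
  rw [e]
  calc _ ≤ |p 0 * (cos θ - cos φ)| + |p 1 * (sin θ - sin φ)| := abs_add_le _ _
    _ = |p 0| * |cos θ - cos φ| + |p 1| * |sin θ - sin φ| := by rw [abs_mul, abs_mul]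
    _ ≤ ‖p‖ * |θ - φ| + ‖p‖ * |θ - φ| := by gcongr
    _ = _ := by ring

theorem continuous_reach {S : Set Plane} (hne : S.Nonempty) (hS : Bornology.IsBounded S) :
    Continuous (reach S) := by
  obtain ⟨C, hC⟩ := hS.exists_norm_le
  have hC0 : 0 ≤ C := by obtain ⟨p, hp⟩ := hne; exact (norm_nonneg p).trans (hC p hp)
  have key : ∀ θ φ, reach S θ ≤ reach S φ + 2 * C * |θ - φ| := by
    intro θ φ
    refine reach_le hne fun p hp => ?_
    have h1 := dirCoord_le_reach hS φ hp
    have h2 := (le_abs_self _).trans (abs_dirCoord_sub_le θ φ p)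
    have h3 : 2 * ‖p‖ * |θ - φ| ≤ 2 * C * |θ - φ| := by gcongr; exact hC p hp
    linarith
  refine (LipschitzWith.of_le_add_mul (Real.toNNReal (2 * C)) fun θ φ => ?_).continuous
  rw [Real.coe_toNNReal _ (by positivity), Real.dist_eq]
  exact key θ φ

theorem measurableSet_ccwArc (θ₀ θ₁ : ℝ) : MeasurableSet (ccwArc θ₀ θ₁) := by
  have : ccwArc θ₀ θ₁ = ⋃ k : ℤ, (fun θ : ℝ => θ + k * (2 * π)) ⁻¹' Icc θ₀ θ₁ := by
    ext θ; simp only [ccwArc, mem_setOf_eq, mem_iUnion, mem_preimage]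
  rw [this]
  exact MeasurableSet.iUnion fun k => measurableSet_Icc.preimage (by fun_prop)

theorem isBounded_segment (P Q : Plane) : Bornology.IsBounded (segment ℝ P Q) := by
  rw [← convexHull_pair]
  exact isBounded_convexHull.2 (Set.toFinite {P, Q}).isBounded

theorem intervalIntegrable_ccwReach {A B : Set Plane} (hA : IsRobot A) (hB : IsRobot B)
    (A₀ B₀ A₁ B₁ : Plane) (θ₀ θ₁ a b : ℝ) :
    IntervalIntegrable (ccwReach A B A₀ B₀ A₁ B₁ θ₀ θ₁) volume a b := by
  classical
  have h1 : Continuous (segmentReach A₀ B₀ A₁ B₁) := by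
    have hA' := continuous_reach ⟨_, left_mem_segment ℝ A₀ A₁⟩ (isBounded_segment A₀ A₁)
    have hB' := continuous_reach ⟨_, left_mem_segment ℝ B₀ B₁⟩ (isBounded_segment B₀ B₁)
    exact hA'.add (hB'.comp (by fun_prop))
  have h2 : Continuous (reach (A + B)) :=
    continuous_reach (hA.nonempty.add hB.nonempty) (hA.bounded.add hB.bounded)
  have e : ccwReach A B A₀ B₀ A₁ B₁ θ₀ θ₁ = (ccwArc θ₀ θ₁).piecewise
      (fun θ => max (segmentReach A₀ B₀ A₁ B₁ θ) (reach (A + B) θ)) (segmentReach A₀ B₀ A₁ B₁) := by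
    ext θ; simp [ccwReach, Set.piecewise]
  rw [e, intervalIntegrable_iff]
  have hi : ∀ f : ℝ → ℝ, Continuous f → IntegrableOn f (uIoc a b) volume :=
    fun f hf => (intervalIntegrable_iff.1 (hf.intervalIntegrable a b))
  exact Integrable.piecewise (measurableSet_ccwArc θ₀ θ₁)
    (hi _ (h1.max h2)).integrableOn (hi _ h1).integrableOn

/-! Replace each motion by its trace, the set of positions it visits. The integral of the reach of a
trace is the perimeter of its convex hull (Cauchy), hence at most the length of the motion plus the
segment closing it up: `Motion.integral_reach_trace_le`. The reach of the second trace may be taken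
at `π + θ`, since a shift does not change the integral over a full turn. It remains to bound
`ccwReach` pointwise by the sum of the two reaches (`ccwReach_le_reach_trace`). The segment terms
are bounded because the endpoints lie on the traces. For `θ` in the arc, some configuration of the
co-motion has orientation `θ`; viability makes its separation in that direction nonnegative, so its
positions differ there by at least `reach A θ + reach B θ`. The perimeter bound is proved in
Crofton's way: the width of the trace in each direction is at most half the variation of the
projected closed polygon, up to a small error, and integrating over directions turns projected edges
into lengths. -/

theorem dirCoord_sub (θ : ℝ) (p q : Plane) : dirCoord θ (p - q) = dirCoord θ p - dirCoord θ q := by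
  rw [sub_eq_add_neg, dirCoord_add, dirCoord_neg, sub_eq_add_neg]

/-- Hence `reach S θ + reach S (π + θ)` is the width of `S` in direction `θ`. -/
theorem dirCoord_pi_add (θ : ℝ) (p : Plane) : dirCoord (π + θ) p = -dirCoord θ p := by
  simp only [dirCoord, add_comm π θ, cos_add_pi, sin_add_pi]; ring

theorem continuous_dirCoord (p : Plane) : Continuous fun θ => dirCoord θ p := by
  unfold dirCoord; fun_prop

theorem reach_periodic (S : Set Plane) : Function.Periodic (reach S) (2 * π) := by
  intro θ
  have : dirCoord (θ + 2 * π) = dirCoord θ := by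
    funext p; simp only [dirCoord, cos_add_two_pi, sin_add_two_pi]
  rw [reach, this, reach]

theorem reach_segment_le {S : Set Plane} (hS : Bornology.IsBounded S) {P Q : Plane} (hP : P ∈ S)
    (hQ : Q ∈ S) (θ : ℝ) : reach (segment ℝ P Q) θ ≤ reach S θ := by
  refine reach_le ⟨P, left_mem_segment ℝ P Q⟩ ?_
  rintro _ ⟨a, b, ha, hb, hab, rfl⟩
  have h1 := mul_le_mul_of_nonneg_left (dirCoord_le_reach hS θ hP) ha
  have h2 := mul_le_mul_of_nonneg_left (dirCoord_le_reach hS θ hQ) hb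
  have e : dirCoord θ (a • P + b • Q) = a * dirCoord θ P + b * dirCoord θ Q := by
    simp only [dirCoord, PiLp.add_apply, PiLp.smul_apply, smul_eq_mul]; ring
  have e' : a * reach S θ + b * reach S θ = reach S θ := by rw [← add_mul, hab, one_mul]
  linarith

/-- Equality holds, but only this inequality is needed to pass from the separation to the Minkowski
sum. -/
theorem reach_add_le {A B : Set Plane} (hA : IsRobot A) (hB : IsRobot B) (θ : ℝ) :
    reach (A + B) θ ≤ reach A θ + reach B θ := by
  refine reach_le (hA.nonempty.add hB.nonempty) ?_
  rintro _ ⟨a, ha, b, hb, rfl⟩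
  simp only [dirCoord_add]
  exact add_le_add (dirCoord_le_reach hA.bounded θ ha) (dirCoord_le_reach hB.bounded θ hb)

/-! The perimeter of the convex hull of a curve. -/

theorem integral_abs_cos : ∫ θ in (0 : ℝ)..(2 * π), |cos θ| = 4 := by
  have hi : ∀ a b : ℝ, IntervalIntegrable (fun θ => |cos θ|) volume a b :=
    fun a b => (continuous_cos.abs).intervalIntegrable a b
  have hp : Function.Periodic (fun θ => |cos θ|) π := fun θ => by simp
  have half : ∀ t : ℝ, ∫ θ in t..(t + π), |cos θ| = 2 := by
    intro t
    -- By periodicity, any half turn can be moved to the one on which the cosine is nonnegative.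
    rw [hp.intervalIntegral_add_eq t (-(π / 2)), show -(π / 2) + π = π / 2 by ring]
    have : ∫ θ in (-(π / 2))..(π / 2), |cos θ| = ∫ θ in (-(π / 2))..(π / 2), cos θ := by
      refine intervalIntegral.integral_congr fun θ hθ => ?_
      rw [uIcc_of_le (by linarith [pi_pos])] at hθ
      exact abs_of_nonneg (cos_nonneg_of_mem_Icc hθ)
    rw [this, integral_cos, sin_neg, sin_pi_div_two]; norm_num
  rw [← intervalIntegral.integral_add_adjacent_intervals (hi 0 π) (hi π (2 * π))]
  have h0 := half 0
  have h1 := half π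
  rw [zero_add] at h0
  rw [← two_mul] at h1
  rw [h0, h1]; norm_num

/-- Writing `p` in polar form makes its projection `‖p‖ * cos (θ - arg)`; the phase is irrelevant
over a full period. This converts projected lengths into lengths. -/
theorem integral_abs_dirCoord (p : Plane) :
    ∫ θ in (0 : ℝ)..(2 * π), |dirCoord θ p| = 4 * ‖p‖ := by
  set z : ℂ := ⟨p 0, p 1⟩ with hz
  have hn : ‖z‖ = ‖p‖ := by
    rw [EuclideanSpace.norm_eq, Complex.norm_def, Complex.normSq_apply, Fin.sum_univ_two]
    simp [hz, sq]
  have h1 : ‖z‖ * cos z.arg = p 0 := Complex.norm_mul_cos_arg z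
  have h2 : ‖z‖ * sin z.arg = p 1 := Complex.norm_mul_sin_arg z
  have e : ∀ θ, |dirCoord θ p| = ‖p‖ * |cos (θ - z.arg)| := by
    intro θ
    have : dirCoord θ p = ‖z‖ * cos (θ - z.arg) := by
      rw [dirCoord, ← h1, ← h2, cos_sub]; ring
    rw [this, abs_mul, abs_norm, hn]
  simp only [e]
  rw [intervalIntegral.integral_const_mul,
    intervalIntegral.integral_comp_sub_right (fun θ => |cos θ|) z.arg]
  have hp : Function.Periodic (fun θ => |cos θ|) (2 * π) := fun θ => by simp
  have := hp.intervalIntegral_add_eq (0 - z.arg) 0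
  rw [show 0 - z.arg + 2 * π = 2 * π - z.arg by ring, zero_add, integral_abs_cos] at this
  rw [this, mul_comm]

theorem abs_sub_le_sum_Ico (x : ℕ → ℝ) {i j : ℕ} (hij : i ≤ j) :
    |x j - x i| ≤ ∑ k ∈ Finset.Ico i j, |x (k + 1) - x k| := by
  rw [← Finset.sum_Ico_sub x hij]
  exact Finset.abs_sum_le_sum_abs _ _

/-- A closed polygon on the line covers the distance between any two of its vertices twice. -/
theorem two_mul_abs_sub_le_closed_sum (x : ℕ → ℝ) {n i j : ℕ} (hij : i ≤ j) (hj : j ≤ n) :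
    2 * |x j - x i| ≤ ∑ k ∈ Finset.range n, |x (k + 1) - x k| + |x n - x 0| := by
  have h1 := abs_sub_le_sum_Ico x hij
  have h2 := abs_sub_le_sum_Ico x (Nat.zero_le i)
  have h3 := abs_sub_le_sum_Ico x hj
  rw [Finset.range_eq_Ico, ← Finset.sum_Ico_consecutive _ (Nat.zero_le i) (hij.trans hj),
    ← Finset.sum_Ico_consecutive _ hij hj]
  -- The second covering: from `j` to `i` the other way round, through `n`, the closing edge and
  -- `0`.
  have h4 : |x j - x i| ≤ |x n - x j| + |x n - x 0| + |x i - x 0| := by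
    rw [show x j - x i = -(x n - x j) + (x n - x 0) + -(x i - x 0) by ring]
    refine (abs_add_three _ _ _).trans_eq ?_
    rw [abs_neg, abs_neg]
  linarith

theorem two_mul_sub_le_closed_sum (x : ℕ → ℝ) {n i j : ℕ} (hi : i ≤ n) (hj : j ≤ n) :
    2 * (x i - x j) ≤ ∑ k ∈ Finset.range n, |x (k + 1) - x k| + |x n - x 0| := by
  rcases le_total i j with h | h
  · have := two_mul_abs_sub_le_closed_sum x h hj
    linarith [neg_le_abs (x j - x i)]
  · have := two_mul_abs_sub_le_closed_sum x h hi
    linarith [le_abs_self (x i - x j)]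

namespace Motion

variable {Z₀ Z₁ : Plane}

/-- The set of positions visited by a motion. -/
def trace (ξ : Motion Z₀ Z₁) : Set Plane := ξ.path '' Icc 0 1

theorem isBounded_trace (ξ : Motion Z₀ Z₁) : Bornology.IsBounded ξ.trace :=
  (isCompact_Icc.image_of_continuousOn ξ.continuousOn).isBounded

theorem path_mem_trace (ξ : Motion Z₀ Z₁) {t : ℝ} (ht : t ∈ Icc (0 : ℝ) 1) :
    ξ.path t ∈ ξ.trace := ⟨t, ht, rfl⟩

theorem source_mem_trace (ξ : Motion Z₀ Z₁) : Z₀ ∈ ξ.trace := ⟨0, by simp, ξ.source⟩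

theorem target_mem_trace (ξ : Motion Z₀ Z₁) : Z₁ ∈ ξ.trace := ⟨1, by simp, ξ.target⟩

theorem continuous_reach_trace (ξ : Motion Z₀ Z₁) : Continuous (reach ξ.trace) :=
  continuous_reach ⟨_, ξ.source_mem_trace⟩ ξ.isBounded_trace

/-- By uniform continuity, the vertices of a fine enough inscribed polygon come within `ε` of every
point of the trace. -/
theorem exists_uniform_partition (ξ : Motion Z₀ Z₁) {ε : ℝ} (hε : 0 < ε) :
    ∃ n : ℕ, 0 < n ∧ ∀ p ∈ ξ.trace, ∃ k ≤ n, ‖p - ξ.path (k / n)‖ ≤ ε := by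
  have hu := isCompact_Icc.uniformContinuousOn_of_continuous ξ.continuousOn
  obtain ⟨δ, hδ, h⟩ := Metric.uniformContinuousOn_iff.1 hu ε hε
  obtain ⟨n, hn⟩ := exists_nat_one_div_lt hδ
  refine ⟨n + 1, n.succ_pos, ?_⟩
  rintro _ ⟨t, ht, rfl⟩
  have hN : (0 : ℝ) < (n + 1 : ℕ) := by positivity
  -- The chosen node is the last one not after `t`, at distance less than `1 / (n + 1)`.
  have hfl : (⌊t * (n + 1 : ℕ)⌋₊ : ℝ) ≤ t * (n + 1 : ℕ) :=
    Nat.floor_le (mul_nonneg ht.1 hN.le)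
  have hfl' := Nat.lt_floor_add_one (t * (n + 1 : ℕ))
  have hk : ⌊t * (n + 1 : ℕ)⌋₊ ≤ n + 1 :=
    Nat.floor_le_of_le (by nlinarith [ht.2])
  refine ⟨_, hk, ?_⟩
  rw [← dist_eq_norm]
  refine (h _ ht _ ⟨by positivity, (div_le_one hN).2 (by exact_mod_cast hk)⟩ ?_).le
  have h1 : (⌊t * (n + 1 : ℕ)⌋₊ : ℝ) / (n + 1 : ℕ) ≤ t := (div_le_iff₀ hN).2 hfl
  have h2 : t < (⌊t * (n + 1 : ℕ)⌋₊ : ℝ) / (n + 1 : ℕ) + 1 / (n + 1 : ℕ) := by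
    rw [← add_div]; exact (lt_div_iff₀ hN).2 hfl'
  rw [Real.dist_eq, abs_of_nonneg (by linarith)]
  push_cast at h2 hn ⊢
  linarith

theorem sum_norm_sub_le_length (ξ : Motion Z₀ Z₁) {n : ℕ} (hn : 0 < n) :
    ∑ k ∈ Finset.range n, ‖ξ.path ((k + 1 : ℕ) / n) - ξ.path (k / n)‖ ≤ ξ.length := by
  have hN : (0 : ℝ) < n := by exact_mod_cast hn
  have h := eVariationOn.sum_le_of_monotoneOn_Iic (f := ξ.path) (s := Icc (0 : ℝ) 1) (n := n)
    (u := fun k : ℕ => (k : ℝ) / n)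
    (fun a _ b _ hab => by
      have : (a : ℝ) ≤ b := by exact_mod_cast hab
      dsimp only; gcongr)
    (fun k hk => ⟨by positivity, (div_le_one hN).2 (by exact_mod_cast hk)⟩)
  -- Rectifiability is essential here: `toReal` would send an infinite length to `0`.
  have h' := ENNReal.toReal_mono ξ.rectifiable h
  rw [ENNReal.toReal_sum (fun _ _ => edist_ne_top _ _)] at h'
  simp only [edist_dist, ENNReal.toReal_ofReal dist_nonneg] at h'
  simpa only [dist_eq_norm, Motion.length] using h'

/-- The closed curve formed by a motion and the segment joining its ends is at least as long as the
perimeter of its convex hull, which is the integral of the reach. -/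
theorem integral_reach_trace_le (ξ : Motion Z₀ Z₁) :
    ∫ θ in (0 : ℝ)..(2 * π), reach ξ.trace θ ≤ ξ.length + dist Z₀ Z₁ := by
  have hcont := ξ.continuous_reach_trace
  have hcont' : Continuous fun θ => reach ξ.trace (π + θ) := hcont.comp (by fun_prop)
  have hshift : ∫ θ in (0 : ℝ)..(2 * π), reach ξ.trace (π + θ)
      = ∫ θ in (0 : ℝ)..(2 * π), reach ξ.trace θ := by
    rw [intervalIntegral.integral_comp_add_left (reach ξ.trace) π, add_zero,
      (reach_periodic ξ.trace).intervalIntegral_add_eq π 0, zero_add]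
  refine le_of_forall_pos_le_add fun δ hδ => ?_
  -- The pointwise error `4 * ε`, integrated over a full turn, is `2 * δ`; the width integrates to
  -- twice the reach, which leaves `δ`.
  obtain ⟨n, hn, hdense⟩ := ξ.exists_uniform_partition (show 0 < δ / (4 * π) by positivity)
  set ε := δ / (4 * π) with hε
  set p : ℕ → Plane := fun k => ξ.path (k / n) with hp
  have hN : (n : ℝ) ≠ 0 := by exact_mod_cast hn.ne'
  have hp0 : p 0 = Z₀ := by simp [hp, ξ.source]
  have hpn : p n = Z₁ := by simp [hp, div_self hN, ξ.target]
  -- The width is nearly attained between two vertices. Replacing each of two points by a vertex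
  -- costs `2 * ε`, the `2` being that of `abs_dirCoord_le`.
  have hpt : ∀ θ, reach ξ.trace θ + reach ξ.trace (π + θ)
      ≤ (∑ k ∈ Finset.range n, |dirCoord θ (p (k + 1) - p k)| + |dirCoord θ (p n - p 0)|) / 2
        + 4 * ε := by
    intro θ
    have hpair : ∀ q ∈ ξ.trace, ∀ q' ∈ ξ.trace, dirCoord θ q + dirCoord (π + θ) q'
        ≤ (∑ k ∈ Finset.range n, |dirCoord θ (p (k + 1) - p k)| + |dirCoord θ (p n - p 0)|) / 2
          + 4 * ε := by
      intro q hq q' hq'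
      obtain ⟨i, hi, hqi⟩ := hdense q hq
      obtain ⟨j, hj, hqj⟩ := hdense q' hq'
      have h1 := (le_abs_self _).trans (abs_dirCoord_le θ (q - p i))
      have h2 := (neg_le_abs _).trans (abs_dirCoord_le θ (q' - p j))
      have h3 := two_mul_sub_le_closed_sum (fun k => dirCoord θ (p k)) hi hj
      simp only [← dirCoord_sub] at h3
      rw [dirCoord_sub] at h1 h2 h3
      rw [dirCoord_pi_add]
      change ‖q - p i‖ ≤ ε at hqi
      change ‖q' - p j‖ ≤ ε at hqj
      linarith
    have hne : ξ.trace.Nonempty := ⟨_, ξ.source_mem_trace⟩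
    -- The two suprema are bounded one at a time, the other term being moved to the right-hand side.
    rw [← le_sub_iff_add_le]
    refine reach_le hne fun q hq => ?_
    rw [le_sub_comm]
    refine reach_le hne fun q' hq' => ?_
    linarith [hpair q hq q' hq']
  have hint : ∀ q : Plane, IntervalIntegrable (fun θ => |dirCoord θ q|) volume 0 (2 * π) :=
    fun q => (continuous_dirCoord q).abs.intervalIntegrable _ _
  have hsum : IntervalIntegrable
      (fun θ => ∑ k ∈ Finset.range n, |dirCoord θ (p (k + 1) - p k)|) volume 0 (2 * π) :=
    (continuous_finsetSum _ fun k _ => (continuous_dirCoord _).abs).intervalIntegrable _ _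
  have hmono := intervalIntegral.integral_mono_on (by positivity : (0 : ℝ) ≤ 2 * π)
    ((hcont.add hcont').intervalIntegrable _ _)
    (((hsum.add (hint (p n - p 0))).div_const 2).add intervalIntegrable_const) fun θ _ => hpt θ
  simp only [Pi.add_apply] at hmono
  rw [intervalIntegral.integral_add (hcont.intervalIntegrable _ _)
      (hcont'.intervalIntegrable _ _), hshift,
    intervalIntegral.integral_add ((hsum.add (hint _)).div_const 2) intervalIntegrable_const,
    intervalIntegral.integral_div, intervalIntegral.integral_add hsum (hint _),
    intervalIntegral.integral_finsetSum fun k _ => hint _, intervalIntegral.integral_const] at hmono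
  simp only [integral_abs_dirCoord, ← Finset.mul_sum] at hmono
  have hlen := ξ.sum_norm_sub_le_length hn
  have hd : ‖p n - p 0‖ = dist Z₀ Z₁ := by rw [hp0, hpn, dist_comm, dist_eq_norm]
  have hc : (2 * π - 0) • (4 * ε) = 2 * δ := by
    rw [hε, smul_eq_mul]; field_simp; ring
  rw [hd, hc] at hmono
  change ∑ k ∈ Finset.range n, ‖p (k + 1) - p k‖ ≤ ξ.length at hlen
  linarith

end Motion

/-! ### Pointwise comparison with the reaches of the traces, and the conclusion. -/

theorem segmentReach_le_reach_trace {A₀ B₀ A₁ B₁ : Plane} (m : CoMotion A₀ B₀ A₁ B₁) (θ : ℝ) :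
    segmentReach A₀ B₀ A₁ B₁ θ ≤ reach m.motionA.trace θ + reach m.motionB.trace (π + θ) :=
  add_le_add
    (reach_segment_le m.motionA.isBounded_trace m.motionA.source_mem_trace
      m.motionA.target_mem_trace θ)
    (reach_segment_le m.motionB.isBounded_trace m.motionB.source_mem_trace
      m.motionB.target_mem_trace (π + θ))

/-- In a direction realized as an orientation by a collision-free co-motion, the positions of the
robots get as far apart as the reach of the Minkowski sum. -/
theorem reach_add_le_reach_trace {A B : Set Plane} (hA : IsRobot A) (hB : IsRobot B)
    {A₀ B₀ A₁ B₁ : Plane} (m : CoMotion A₀ B₀ A₁ B₁) (hfree : m.CollisionFree A B) {θ : ℝ}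
    (hθ : θ ∈ m.orientations A B) :
    reach (A + B) θ ≤ reach m.motionA.trace θ + reach m.motionB.trace (π + θ) := by
  obtain ⟨t, ht, hor⟩ := hθ
  obtain ⟨φ, hφ⟩ := hfree t ht
  -- Viability concerns some direction `φ`; maximality at `θ` carries the nonnegative separation
  -- over to `θ`.
  have hsep := hφ.trans (hor φ)
  rw [separation_eq hA hB, dirCoord_sub] at hsep
  have h1 := dirCoord_le_reach m.motionA.isBounded_trace θ (m.motionA.path_mem_trace ht)
  have h2 := dirCoord_le_reach m.motionB.isBounded_trace (π + θ) (m.motionB.path_mem_trace ht)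
  rw [dirCoord_pi_add] at h2
  linarith [reach_add_le hA hB θ]

theorem ccwReach_le_reach_trace {A B : Set Plane} (hA : IsRobot A) (hB : IsRobot B)
    {A₀ B₀ A₁ B₁ : Plane} {θ₀ θ₁ : ℝ} (m : CoMotion A₀ B₀ A₁ B₁) (hfree : m.CollisionFree A B)
    (hccw : m.NetCCW A B θ₀ θ₁) (θ : ℝ) :
    ccwReach A B A₀ B₀ A₁ B₁ θ₀ θ₁ θ
      ≤ reach m.motionA.trace θ + reach m.motionB.trace (π + θ) := by
  unfold ccwReach
  split_ifs with h
  · exact max_le (segmentReach_le_reach_trace m θ)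
      (reach_add_le_reach_trace hA hB m hfree (hccw h))
  · exact segmentReach_le_reach_trace m θ

theorem mainTheorem6 (A B : Set Plane) (hA : IsRobot A) (hB : IsRobot B)
    (A₀ B₀ A₁ B₁ : Plane) (θ₀ θ₁ : ℝ)
    (h₀ : IsOrientation A B A₀ B₀ θ₀) (h₁ : IsOrientation A B A₁ B₁ θ₁)
    (hle : θ₀ ≤ θ₁) (hturn : θ₁ ≤ θ₀ + 2 * π)
    (m : CoMotion A₀ B₀ A₁ B₁) (hfree : m.CollisionFree A B) (hccw : m.NetCCW A B θ₀ θ₁) :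
    (∫ θ in (0 : ℝ)..(2 * π), ccwReach A B A₀ B₀ A₁ B₁ θ₀ θ₁ θ) - dist A₀ A₁ - dist B₀ B₁
      ≤ m.length := by
  have hcA := m.motionA.continuous_reach_trace
  have hcB : Continuous fun θ => reach m.motionB.trace (π + θ) :=
    m.motionB.continuous_reach_trace.comp (by fun_prop)
  have hmono := intervalIntegral.integral_mono_on (by positivity : (0 : ℝ) ≤ 2 * π)
    (intervalIntegrable_ccwReach hA hB A₀ B₀ A₁ B₁ θ₀ θ₁ 0 (2 * π))
    ((hcA.add hcB).intervalIntegrable _ _)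
    fun θ _ => ccwReach_le_reach_trace hA hB m hfree hccw θ
  simp only [Pi.add_apply] at hmono
  rw [intervalIntegral.integral_add (hcA.intervalIntegrable _ _) (hcB.intervalIntegrable _ _),
    intervalIntegral.integral_comp_add_left (reach m.motionB.trace) π, add_zero,
    (reach_periodic m.motionB.trace).intervalIntegral_add_eq π 0, zero_add] at hmono
  have hlA := m.motionA.integral_reach_trace_le
  have hlB := m.motionB.integral_reach_trace_le
  rw [CoMotion.length]
  linarith
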